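/- Consider the non-stationary dueling bandits problem with $K$ arms, time horizon $T$ and $M$ segments. An instance consists of changepoints $1=\nu_0<\nu_1<\dots<\nu_M=T+1$ and, for each segment $S_m=\{\nu_{m-1},\dots,\nu_m-1\}$, a preference matrix $P^{(m)}\in[0,1]^{K\times K}$ with $P^{(m)}_{i,j}+P^{(m)}_{j,i}=1$ for all $i,j$ that has a Condorcet winner $m^*$, i.e. $P^{(m)}_{m^*,i}>\frac12$ for all $i\ne m^*$. In each time step $t\in S_m$ the (possibly randomized) algorithm chooses, depending on the history of its previous pairs and observed outcomes, a pair of arms $(I_t,J_t)$ (possibly $I_t=J_t$), and then observes the outcome of a duel, which is distributed as $\mathrm{Ber}(P^{(m)}_{I_t,J_t})$ and, given the pair, independent of the past. With $\Delta_i^{(m)}=P^{(m)}_{m^*,i}-\frac12$, the weak regret in step $t\in S_m$ is $r_t^{\mathrm W}=\min\{\Delta^{(m)}_{I_t},\Delta^{(m)}_{J_t}\}$ and the binary weak regret is $r_t^{\bar{\mathrm W}}=\lceil r_t^{\mathrm W}\rceil$; put $R^{\mathrm W}=\sum_{t=1}^T r_t^{\mathrm W}$ and $R^{\bar{\mathrm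 W}}=\sum_{t=1}^T r_t^{\bar{\mathrm W}}$. The problem is called stationary if $M=1$. **Theorem.** (i) There is an absolute constant $c>0$ such that for all $K\ge 3$, $1\le M\le T$ with $M(K-1)\le 9T$ and for every algorithm there is an instance with $K$ arms, $M$ segments and horizon $T$ on which $$\mathbb E[R^{\mathrm W}]\ge c\sqrt{KMT}\quad\text{and}\quad \mathbb E[R^{\bar{\mathrm W}}]\ge c\sqrt{KMT}.$$ (ii) There is an absolute constant $c>0$ such that for all $K\ge 3$, $T\ge 1$ with $K-1\le 9T$ and for every algorithm there is a stationary instance with $K$ arms and horizon $T$ on which $$\mathbb E[R^{\mathrm W}]\ge c\sqrt{KT}\quad\text{and}\quad \mathbb E[R^{\bar{\mathrm W}}]\ge c\sqrt{KT}.$$ -/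

import Mathlib

noncomputable section

namespace DuelingBandits

open scoped BigOperators

/-- A preference matrix on `K` arms: `prob i j` is the probability that arm `i` wins a duel
against arm `j`; there is an arm (the Condorcet winner, unique by `winner_beats`) that beats
every other arm with probability greater than one half. -/
structure PreferenceMatrix (K : ℕ) where
  prob : Fin K → Fin K → ℝ
  prob_mem : ∀ i j, prob i j ∈ Set.Icc (0 : ℝ) 1
  prob_add_prob : ∀ i j, prob i j + prob j i = 1
  winner : Fin K
  winner_beats : ∀ i, i ≠ winner → 1 / 2 < prob winner i

namespace PreferenceMatrix

variable {K : ℕ}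

/-- The Bernoulli law with parameter `prob i j` of the outcome of the duel of `i` and `j`;
`true` means that `i` wins. -/
def duel (P : PreferenceMatrix K) (i j : Fin K) : PMF Bool :=
  PMF.ofFintype (fun b => ENNReal.ofReal (bif b then P.prob i j else 1 - P.prob i j)) (by
    have h := P.prob_mem i j
    rw [Fintype.sum_bool, cond_true, cond_false,
      ← ENNReal.ofReal_add h.1 (sub_nonneg.2 h.2)]
    simp)

/-- The suboptimality gap of arm `i`. -/
def gap (P : PreferenceMatrix K) (i : Fin K) : ℝ := P.prob P.winner i - 1 / 2

/-- The instantaneous weak regret of playing the pair `(a.1, a.2)`. -/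
def weakRegret (P : PreferenceMatrix K) (a : Fin K × Fin K) : ℝ := min (P.gap a.1) (P.gap a.2)

/-- The instantaneous binary weak regret of playing the pair `(a.1, a.2)`. -/
def binaryWeakRegret (P : PreferenceMatrix K) (a : Fin K × Fin K) : ℝ :=
  (⌈P.weakRegret a⌉ : ℤ)

end PreferenceMatrix

/-- An instance of the non-stationary dueling bandits problem with `K` arms, time horizon `T` and
`M` stationary segments: changepoints `1 = ν 0 < ν 1 < ⋯ < ν M = T + 1` and a preference matrix
for each segment. -/
structure Instance (K M T : ℕ) where
  ν : Fin (M + 1) → ℕ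
  ν_strictMono : StrictMono ν
  ν_zero : ν 0 = 1
  ν_last : ν (Fin.last M) = T + 1
  pref : Fin M → PreferenceMatrix K

/-- An instance of the stationary dueling bandits problem: there is a single segment. -/
abbrev StationaryInstance (K T : ℕ) := Instance K 1 T

namespace Instance

variable {K M T : ℕ}

/-- The `m`-th stationary segment, a set of time steps in `{1, …, T}`. -/
def stationarySegment (I : Instance K M T) (m : Fin M) : Finset ℕ :=
  Finset.Ico (I.ν m.castSucc) (I.ν m.succ)

theorem exists_mem_stationarySegment (I : Instance K M T) (t : Fin T) :
    ∃ m : Fin M, (t : ℕ) + 1 ∈ I.stationarySegment m := by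
  by_contra! hcon
  have key : ∀ m : Fin (M + 1), I.ν m ≤ (t : ℕ) + 1 := by
    intro m
    induction m using Fin.induction with
    | zero => rw [I.ν_zero]; omega
    | succ i ih =>
      have h := hcon i
      simp only [stationarySegment, Finset.mem_Ico, not_and, not_lt] at h
      exact h ih
  have h := key (Fin.last M)
  rw [I.ν_last] at h
  have := t.isLt
  omega

/-- The index of the segment that contains the time step `t + 1` (the elements `t` of `Fin T`
count the time steps from zero). -/
def segmentOf (I : Instance K M T) (t : Fin T) : Fin M :=
  (I.exists_mem_stationarySegment t).choose

theorem mem_stationarySegment_segmentOf (I : Instance K M T) (t : Fin T) :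
    (t : ℕ) + 1 ∈ I.stationarySegment (I.segmentOf t) :=
  (I.exists_mem_stationarySegment t).choose_spec

/-- The preference matrix in force at the time step `t + 1`. -/
def prefAt (I : Instance K M T) (t : Fin T) : PreferenceMatrix K := I.pref (I.segmentOf t)

end Instance

/-- What the learner sees in one time step: the pair that it played and the outcome of the duel. -/
abbrev Round (K : ℕ) := (Fin K × Fin K) × Bool

/-- The histories of the first `t` time steps. -/
abbrev History (K t : ℕ) := Fin t → Round K

/-- A (possibly randomized) algorithm for `K` arms: the conditional law of the next pair of arms
given the history so far. Both arms of a pair may coincide. -/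
structure Algorithm (K : ℕ) where
  choosePair : (t : ℕ) → History K t → PMF (Fin K × Fin K)

variable {K M T : ℕ}

/-- The law of the history of the first `t` time steps when the algorithm `A` runs on the
instance `I`: in each step the algorithm draws a pair from the history, and then the outcome
of the duel is drawn, independently of the past given this pair, from the preference matrix
in force. -/
def historyLaw (A : Algorithm K) (I : Instance K M T) : (t : ℕ) → t ≤ T → PMF (History K t)
  | 0, _ => PMF.pure Fin.elim0
  | t + 1, ht =>
    (historyLaw A I t (Nat.le_of_succ_le ht)).bind fun h =>
      (A.choosePair t h).bind fun a =>
        ((I.prefAt ⟨t, ht⟩).duel a.1 a.2).map fun x =>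
          (Fin.snoc (α := fun _ => Round K) h (a, x) : History K (t + 1))

/-- The expectation of a function of the full history (there are finitely many histories). -/
def expectation (A : Algorithm K) (I : Instance K M T) (f : History K T → ℝ) : ℝ :=
  ∑ h : History K T, (historyLaw A I T le_rfl h).toReal * f h

/-- The expected cumulative weak regret of the algorithm `A` on the instance `I`. -/
def expectedWeakRegret (A : Algorithm K) (I : Instance K M T) : ℝ :=
  expectation A I fun h => ∑ t : Fin T, (I.prefAt t).weakRegret (h t).1

/-- The expected cumulative binary weak regret of the algorithm `A` on the instance `I`. -/
def expectedBinaryWeakRegret (A : Algorithm K) (I : Instance K M T) : ℝ :=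
  expectation A I fun h => ∑ t : Fin T, (I.prefAt t).binaryWeakRegret (h t).1

end DuelingBandits

end

/-!
Fix a small advantage `ε` and cut the horizon into `M` segments of almost equal length. In each
segment one arm wins every duel with probability `1 / 2 + ε` and all other duels are fair, so each
step that misses this arm costs weak regret `ε`. Compare a segment `S` with the environment in which
its duels are all fair. There all arms together are played at most `2 * #S` times, that is, at most
`2 * #S / K` times per arm on average, and the relative entropy of the fair environment with
respect to the one with winner `i` is at most `4 * ε ^ 2` times the expected number of plays of `i`.
Hence, as long as `ε ^ 2 * #S` is a small multiple of `K`, the average arm remains hard to find when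
it is the winner. Averaging over all assignments of winners to segments yields an instance with weak
regret of order `ε * T`, and `ε` of order `√(K * M / T)` is admissible.
-/

noncomputable section

namespace DuelingBandits

open Finset

section Mean

variable {α β ι : Type*} [Fintype α] [Fintype β]

/-- The expected value of a real function under a probability mass function on a finite type. -/
def mean (p : PMF α) (f : α → ℝ) : ℝ := ∑ a, (p a).toReal * f a

theorem mean_const (p : PMF α) (c : ℝ) : mean p (fun _ => c) = c := by
  have hp : ∑ a, (p a).toReal = 1 := by
    rw [← ENNReal.toReal_sum fun a _ => p.apply_ne_top a, ← tsum_fintype (L := .unconditional _),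
      p.tsum_coe, ENNReal.toReal_one]
  rw [mean, ← sum_mul, hp, one_mul]

theorem mean_add (p : PMF α) (f g : α → ℝ) :
    mean p (fun a => f a + g a) = mean p f + mean p g := by
  simp only [mean, mul_add, sum_add_distrib]

theorem mean_sub (p : PMF α) (f g : α → ℝ) :
    mean p (fun a => f a - g a) = mean p f - mean p g := by
  simp only [mean, mul_sub, sum_sub_distrib]

theorem mean_const_mul (p : PMF α) (c : ℝ) (f : α → ℝ) :
    mean p (fun a => c * f a) = c * mean p f := by
  simp only [mean, mul_sum, mul_left_comm]

theorem mean_sum (p : PMF α) (s : Finset ι) (f : ι → α → ℝ) :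
    mean p (fun a => ∑ i ∈ s, f i a) = ∑ i ∈ s, mean p (f i) := by
  simp only [mean, mul_sum]
  exact sum_comm

theorem mean_mono (p : PMF α) {f g : α → ℝ} (hfg : ∀ a, f a ≤ g a) : mean p f ≤ mean p g :=
  sum_le_sum fun a _ => mul_le_mul_of_nonneg_left (hfg a) ENNReal.toReal_nonneg

theorem mean_pure (a : α) (f : α → ℝ) : mean (PMF.pure a) f = f a := by
  classical
  rw [mean, sum_eq_single a (fun b _ hb => by simp [PMF.pure_apply, hb]) (by simp)]
  simp

theorem mean_bind (p : PMF α) (q : α → PMF β) (f : β → ℝ) :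
    mean (p.bind q) f = mean p fun a => mean (q a) f := by
  have hbind : ∀ b, (p.bind q b).toReal = ∑ a, (p a).toReal * (q a b).toReal := fun b => by
    rw [PMF.bind_apply, tsum_fintype,
      ENNReal.toReal_sum fun a _ => ENNReal.mul_ne_top (p.apply_ne_top a) ((q a).apply_ne_top b)]
    simp only [ENNReal.toReal_mul]
  simp only [mean, hbind, sum_mul, mul_sum, mul_assoc]
  exact sum_comm

theorem mean_map (p : PMF α) (g : α → β) (f : β → ℝ) :
    mean (p.map g) f = mean p fun a => f (g a) := by
  simp only [← PMF.bind_pure_comp, mean_bind, Function.comp_apply, mean_pure]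

end Mean

section ChangeOfMeasure

theorem abs_sub_one_le_add_log {x c : ℝ} (hx : 0 < x) (hc : 0 < c) :
    |x - 1| ≤ (x + 1) / c + c / 2 * (x - 1 - Real.log x) := by
  obtain ⟨s, hs, rfl⟩ : ∃ s : ℝ, 0 < s ∧ s ^ 2 = x := ⟨√x, Real.sqrt_pos.2 hx, Real.sq_sqrt hx.le⟩
  have hlog : (s - 1) ^ 2 ≤ s ^ 2 - 1 - Real.log (s ^ 2) := by
    have := Real.log_le_sub_one_of_pos hs
    rw [Real.log_pow]
    push_cast
    linarith
  have hamgm : |s - 1| * (s + 1) ≤ (s + 1) ^ 2 / (2 * c) + c / 2 * (s - 1) ^ 2 := by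
    have hsq : 0 ≤ ((s + 1) - c * |s - 1|) ^ 2 / (2 * c) := by positivity
    rw [← sq_abs (s - 1)]
    calc |s - 1| * (s + 1) ≤ |s - 1| * (s + 1) + ((s + 1) - c * |s - 1|) ^ 2 / (2 * c) := by
          linarith
      _ = (s + 1) ^ 2 / (2 * c) + c / 2 * |s - 1| ^ 2 := by
          field_simp
          ring
  calc |s ^ 2 - 1| = |s - 1| * (s + 1) := by
        rw [← abs_of_pos (by linarith : 0 < s + 1), ← abs_mul]
        ring_nf
    _ ≤ (s + 1) ^ 2 / (2 * c) + c / 2 * (s - 1) ^ 2 := hamgm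
    _ ≤ 2 * (s ^ 2 + 1) / (2 * c) + c / 2 * (s ^ 2 - 1 - Real.log (s ^ 2)) := by
        gcongr
        linarith [sq_nonneg (s - 1)]
    _ = (s ^ 2 + 1) / c + c / 2 * (s ^ 2 - 1 - Real.log (s ^ 2)) := by
        rw [mul_div_mul_left _ _ two_ne_zero]

/-- A form of Pinsker's inequality that is linear in the relative entropy, so that it can be summed
over the possible winners without a further use of concavity. -/
theorem mean_likelihood_mul_le {α : Type*} [Fintype α] (p : PMF α) {l f : α → ℝ} {N c : ℝ}
    (hl : ∀ a, 0 < l a) (hlp : mean p l = 1) (hf : ∀ a, 0 ≤ f a) (hfN : ∀ a, f a ≤ N)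
    (hc : 0 < c) :
    mean p (fun a => l a * f a) ≤
      mean p f + N * (2 / c + c / 2 * mean p fun a => -Real.log (l a)) := by
  have hpoint : ∀ a, l a * f a ≤
      f a + N * (1 / c * (l a + 1) + c / 2 * (l a - 1 + -Real.log (l a))) := fun a => by
    have h : (l a - 1) * f a ≤ ((l a + 1) / c + c / 2 * (l a - 1 - Real.log (l a))) * N :=
      calc (l a - 1) * f a ≤ |l a - 1| * f a := by gcongr; exacts [hf a, le_abs_self _]
        _ ≤ |l a - 1| * N := by gcongr; exact hfN a
        _ ≤ _ := mul_le_mul_of_nonneg_right (abs_sub_one_le_add_log (hl a) hc)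
          ((hf a).trans (hfN a))
    linear_combination h
  calc mean p (fun a => l a * f a)
      ≤ mean p fun a => f a + N * (1 / c * (l a + 1) + c / 2 * (l a - 1 + -Real.log (l a))) :=
        mean_mono p hpoint
    _ = mean p f + N * (2 / c + c / 2 * mean p fun a => -Real.log (l a)) := by
        simp only [mean_add, mean_sub, mean_const_mul, mean_const, hlp]
        ring

end ChangeOfMeasure

section Interaction

variable {K M T n : ℕ}

/-- The conditional laws of the outcomes of the duels in `n` time steps. Unlike in an `Instance`,
they need not come from preference matrices. -/
abbrev Environment (K n : ℕ) := Fin n → Fin K × Fin K → PMF Bool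

/-- The environment in which the duels of an instance take place. -/
def Instance.environment (I : Instance K M T) : Environment K T :=
  fun t a => (I.prefAt t).duel a.1 a.2

/-- The law of the history when the algorithm `A` runs in the environment `E`. -/
def interactionLaw (A : Algorithm K) : {n : ℕ} → Environment K n → PMF (History K n)
  | 0, _ => PMF.pure Fin.elim0
  | n + 1, E =>
    (interactionLaw A fun t => E t.castSucc).bind fun h =>
      (A.choosePair n h).bind fun a =>
        (E (Fin.last n) a).map fun x => Fin.snoc (α := fun _ => Round K) h (a, x)

theorem historyLaw_eq_interactionLaw (A : Algorithm K) (I : Instance K M T) (hn : n ≤ T) :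
    historyLaw A I n hn = interactionLaw A fun t => I.environment (t.castLE hn) := by
  induction n with
  | zero => rfl
  | succ n ih =>
    rw [historyLaw, ih]
    rfl

theorem expectation_eq_mean (A : Algorithm K) (I : Instance K M T) (f : History K T → ℝ) :
    expectation A I f = mean (interactionLaw A I.environment) f := by
  rw [expectation, historyLaw_eq_interactionLaw]
  rfl

theorem mean_interactionLaw_succ (A : Algorithm K) (E : Environment K (n + 1))
    (f : History K (n + 1) → ℝ) :
    mean (interactionLaw A E) f =
      mean (interactionLaw A fun t => E t.castSucc) fun h => mean (A.choosePair n h) fun a =>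
        mean (E (Fin.last n) a) fun x => f (Fin.snoc (α := fun _ => Round K) h (a, x)) := by
  simp only [interactionLaw, mean_bind, mean_map]

theorem mean_interactionLaw_round (A : Algorithm K) (E : Environment K n) (t : Fin n)
    (f : Round K → ℝ) :
    mean (interactionLaw A E) (fun h => f (h t)) =
      mean (interactionLaw A E) fun h => mean (E t (h t).1) fun x => f ((h t).1, x) := by
  induction n with
  | zero => exact t.elim0
  | succ n ih =>
    cases t using Fin.lastCases with
    | last => simp only [mean_interactionLaw_succ, Fin.snoc_last, mean_const]
    | cast t =>
      simp only [mean_interactionLaw_succ, Fin.snoc_castSucc, mean_const]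
      exact ih (fun t => E t.castSucc) t

theorem mean_interactionLaw_of_likelihood (A : Algorithm K) {E E' : Environment K n}
    {l : Fin n → Round K → ℝ}
    (hE : ∀ t a x, (E' t a x).toReal = (E t a x).toReal * l t (a, x)) (f : History K n → ℝ) :
    mean (interactionLaw A E') f =
      mean (interactionLaw A E) fun h => (∏ t, l t (h t)) * f h := by
  induction n with
  | zero => simp only [interactionLaw, mean_pure, univ_eq_empty, prod_empty, one_mul]
  | succ n ih =>
    have hround : ∀ a (g : Bool → ℝ), mean (E' (Fin.last n) a) g =
        mean (E (Fin.last n) a) fun x => l (Fin.last n) (a, x) * g x := fun a g => by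
      simp only [mean, hE, mul_assoc]
    rw [mean_interactionLaw_succ, mean_interactionLaw_succ, ih fun t => hE t.castSucc]
    simp only [hround, Fin.prod_univ_castSucc, Fin.snoc_castSucc, Fin.snoc_last, mul_assoc,
      mean_const_mul]

theorem mean_neg_log_likelihood (A : Algorithm K) (E : Environment K n) {l : Fin n → Round K → ℝ}
    (hl : ∀ t r, 0 < l t r) :
    mean (interactionLaw A E) (fun h => -Real.log (∏ t, l t (h t))) =
      mean (interactionLaw A E) fun h =>
        ∑ t, mean (E t (h t).1) fun x => -Real.log (l t ((h t).1, x)) := by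
  simp only [Real.log_prod fun t _ => (hl t _).ne', ← sum_neg_distrib, mean_sum]
  exact sum_congr rfl fun t _ => mean_interactionLaw_round A E t fun r => -Real.log (l t r)

theorem mean_interactionLaw_le_of_likelihood (A : Algorithm K) {E E' : Environment K n}
    {l : Fin n → Round K → ℝ} (hl : ∀ t r, 0 < l t r)
    (hE : ∀ t a x, (E' t a x).toReal = (E t a x).toReal * l t (a, x))
    {f : History K n → ℝ} {N c : ℝ} (hf : ∀ h, 0 ≤ f h) (hfN : ∀ h, f h ≤ N) (hc : 0 < c) :
    mean (interactionLaw A E') f ≤ mean (interactionLaw A E) f +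
      N * (2 / c + c / 2 * mean (interactionLaw A E) fun h =>
        ∑ t, mean (E t (h t).1) fun x => -Real.log (l t ((h t).1, x))) := by
  have hmass : mean (interactionLaw A E) (fun h => ∏ t, l t (h t)) = 1 := by
    simpa only [mul_one, mean_const] using
      (mean_interactionLaw_of_likelihood A hE fun _ => 1).symm
  rw [mean_interactionLaw_of_likelihood A hE, ← mean_neg_log_likelihood A E hl]
  exact mean_likelihood_mul_le _ (fun h => prod_pos fun t _ => hl t _) hmass hf hfN hc

end Interaction

section SingleWinner

variable {K n : ℕ}

/-- The set of the arms in a pair. -/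
def arms (a : Fin K × Fin K) : Finset (Fin K) := {a.1, a.2}

/-- The number of time steps of `S` in which the arm `k` is played. -/
def playCount (S : Finset (Fin n)) (k : Fin K) (h : History K n) : ℕ := #{t ∈ S | k ∈ arms (h t).1}

theorem playCount_le_card (S : Finset (Fin n)) (k : Fin K) (h : History K n) :
    playCount S k h ≤ #S :=
  card_filter_le _ _

theorem sum_playCount_le (S : Finset (Fin n)) (h : History K n) :
    ∑ k, playCount S k h ≤ 2 * #S := by
  calc ∑ k, playCount S k h = ∑ t ∈ S, #(arms (h t).1) := by
        simp only [playCount, card_filter]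
        rw [sum_comm]
        simp
    _ ≤ ∑ _t ∈ S, 2 := sum_le_sum fun _ _ => card_le_two
    _ = 2 * #S := by rw [sum_const, smul_eq_mul, mul_comm]

/-- The law of the outcome of a duel of two equally strong arms. -/
def fairDuel : PMF Bool := PMF.uniformOfFintype Bool

theorem mean_fairDuel (f : Bool → ℝ) : mean fairDuel f = (f true + f false) / 2 := by
  simp [mean, fairDuel]
  ring

variable {ε : ℝ} (hε : ε ∈ Set.Ioc 0 (1 / 2))

/-- The preference matrix in which `k` beats every other arm with probability `1 / 2 + ε` and all
other duels are fair. -/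
def singleWinner (k : Fin K) : PreferenceMatrix K where
  prob i j := 1 / 2 + ε * ((if i = k then 1 else 0) - (if j = k then 1 else 0))
  prob_mem i j := by
    obtain ⟨hε0, hε1⟩ := hε
    split_ifs <;> constructor <;> linarith
  prob_add_prob i j := by ring
  winner := k
  winner_beats i hi := by simp [hi, hε.1]

theorem weakRegret_singleWinner (k : Fin K) (a : Fin K × Fin K) :
    (singleWinner hε k).weakRegret a = ε * (1 - if k ∈ arms a then 1 else 0) := by
  obtain ⟨i, j⟩ := a
  by_cases hi : i = k <;> by_cases hj : j = k <;>
    simp [PreferenceMatrix.weakRegret, PreferenceMatrix.gap, singleWinner, arms, hi, hj, hε.1.le,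
      eq_comm (a := k)]

theorem sum_weakRegret_singleWinner (S : Finset (Fin n)) (k : Fin K) (h : History K n) :
    ∑ t ∈ S, (singleWinner hε k).weakRegret (h t).1 = ε * (#S - playCount S k h) := by
  simp only [weakRegret_singleWinner, ← mul_sum, sum_sub_distrib, sum_const, nsmul_one, sum_boole,
    playCount]

/-- The likelihood ratio of the outcome of a duel under `singleWinner hε k` and under a fair
duel. -/
def duelLikelihood (k : Fin K) (r : Round K) : ℝ :=
  2 * ((singleWinner hε k).duel r.1.1 r.1.2 r.2).toReal

theorem toReal_duel_eq_fairDuel_mul_duelLikelihood (k : Fin K) (a : Fin K × Fin K) (x : Bool) :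
    ((singleWinner hε k).duel a.1 a.2 x).toReal =
      (fairDuel x).toReal * duelLikelihood hε k (a, x) := by
  simp [fairDuel, duelLikelihood]

theorem duelLikelihood_eq (k : Fin K) (a : Fin K × Fin K) (x : Bool) :
    duelLikelihood hε k (a, x) =
      1 + (bif x then 1 else -1) *
        (2 * ε * ((if a.1 = k then 1 else 0) - (if a.2 = k then 1 else 0))) := by
  have hp := (singleWinner hε k).prob_mem a.1 a.2
  cases x <;>
    simp only [duelLikelihood, PreferenceMatrix.duel, PMF.ofFintype_apply, cond_true, cond_false]
  · rw [ENNReal.toReal_ofReal (sub_nonneg.2 hp.2), singleWinner]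
    ring
  · rw [ENNReal.toReal_ofReal hp.1, singleWinner]
    ring

theorem duelLikelihood_pos (hε' : ε < 1 / 2) (k : Fin K) (r : Round K) :
    0 < duelLikelihood hε k r := by
  obtain ⟨a, x⟩ := r
  have := hε.1
  rw [duelLikelihood_eq]
  cases x <;> simp only [cond_true, cond_false] <;> split_ifs <;> linarith

theorem neg_log_one_sub_le {u : ℝ} (hu : 0 ≤ u) (hu' : u ≤ 1 / 2) : -Real.log (1 - u) ≤ 2 * u := by
  have hlog := Real.one_sub_inv_le_log_of_pos (by linarith : 0 < 1 - u)
  have hinv : (1 - u)⁻¹ ≤ 1 + 2 * u := by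
    rw [inv_le_iff_one_le_mul₀ (by linarith)]
    nlinarith
  linarith

theorem mean_neg_log_duelLikelihood_le (hε' : ε ≤ 1 / 4) (k : Fin K) (a : Fin K × Fin K) :
    mean fairDuel (fun x => -Real.log (duelLikelihood hε k (a, x))) ≤
      if k ∈ arms a then 4 * ε ^ 2 else 0 := by
  set δ : ℝ := 2 * ε * ((if a.1 = k then 1 else 0) - (if a.2 = k then 1 else 0)) with hδ_def
  have hδ : δ ^ 2 ≤ if k ∈ arms a then 4 * ε ^ 2 else 0 := by
    rw [hδ_def]
    by_cases h₁ : a.1 = k <;> by_cases h₂ : a.2 = k <;>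
      simp [arms, h₁, h₂, eq_comm (a := k), mul_pow, sq_nonneg] <;> norm_num
  have hδ' : δ ^ 2 ≤ 1 / 2 := by
    refine hδ.trans ?_
    have := hε.1
    split_ifs <;> nlinarith
  have hpos := fun x => duelLikelihood_pos hε (by linarith) k (a, x)
  calc mean fairDuel (fun x => -Real.log (duelLikelihood hε k (a, x)))
      = -Real.log (duelLikelihood hε k (a, true) * duelLikelihood hε k (a, false)) / 2 := by
        rw [mean_fairDuel, Real.log_mul (hpos _).ne' (hpos _).ne']
        ring
    _ = -Real.log (1 - δ ^ 2) / 2 := by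
        rw [duelLikelihood_eq, duelLikelihood_eq, cond_true, cond_false, ← hδ_def]
        ring_nf
    _ ≤ δ ^ 2 := by linarith [neg_log_one_sub_le (sq_nonneg δ) hδ']
    _ ≤ if k ∈ arms a then 4 * ε ^ 2 else 0 := hδ

end SingleWinner

section Segment

variable {K n : ℕ} {ε : ℝ} (hε : ε ∈ Set.Ioc 0 (1 / 2))

/-- The environment `E` with all duels of the time steps of `S` replaced by fair ones. -/
def fairOn (S : Finset (Fin n)) (E : Environment K n) : Environment K n :=
  S.piecewise (fun _ _ => fairDuel) E

/-- The environment `E` with `k` made the single winner in the time steps of `S`. -/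
def winnerOn (S : Finset (Fin n)) (k : Fin K) (E : Environment K n) : Environment K n :=
  S.piecewise (fun _ a => (singleWinner hε k).duel a.1 a.2) E

theorem mean_winnerOn_playCount_le (hε' : ε ≤ 1 / 4) (A : Algorithm K) (E : Environment K n)
    (S : Finset (Fin n)) (k : Fin K) {c : ℝ} (hc : 0 < c) :
    mean (interactionLaw A (winnerOn hε S k E)) (fun h => playCount S k h) ≤
      mean (interactionLaw A (fairOn S E)) (fun h => playCount S k h) + #S * (2 / c + c / 2 *
        (4 * ε ^ 2 * mean (interactionLaw A (fairOn S E)) fun h => playCount S k h)) := by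
  let l : Fin n → Round K → ℝ := fun t r => if t ∈ S then duelLikelihood hε k r else 1
  have hl : ∀ t r, 0 < l t r := fun t r => by
    simp only [l]
    split_ifs
    exacts [duelLikelihood_pos hε (by linarith) k r, one_pos]
  have hE : ∀ t a x, (winnerOn hε S k E t a x).toReal =
      (fairOn S E t a x).toReal * l t (a, x) := fun t a x => by
    by_cases ht : t ∈ S <;>
      simp [winnerOn, fairOn, l, ht, toReal_duel_eq_fairDuel_mul_duelLikelihood]
  have hstep : ∀ t a, mean (fairOn S E t a) (fun x => -Real.log (l t (a, x))) ≤
      if t ∈ S then if k ∈ arms a then 4 * ε ^ 2 else 0 else 0 := fun t a => by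
    by_cases ht : t ∈ S
    · simpa [fairOn, l, ht] using mean_neg_log_duelLikelihood_le hε hε' k a
    · simp [l, ht, mean_const]
  have hentropy : mean (interactionLaw A (fairOn S E)) (fun h =>
      ∑ t, mean (fairOn S E t (h t).1) fun x => -Real.log (l t ((h t).1, x))) ≤
      4 * ε ^ 2 * mean (interactionLaw A (fairOn S E)) fun h => playCount S k h := by
    rw [← mean_const_mul]
    refine mean_mono _ fun h => (sum_le_sum fun t _ => hstep t (h t).1).trans_eq ?_
    rw [sum_ite_mem, univ_inter, ← sum_filter, sum_const, nsmul_eq_mul, mul_comm, playCount]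
  refine (mean_interactionLaw_le_of_likelihood A hl hE (fun h => Nat.cast_nonneg _)
    (fun h => Nat.cast_le.2 (playCount_le_card S k h)) hc).trans ?_
  gcongr

theorem sum_mean_playCount_le (A : Algorithm K) (E : Environment K n) (S : Finset (Fin n)) :
    ∑ k, mean (interactionLaw A E) (fun h => playCount S k h) ≤ 2 * #S := by
  rw [← mean_sum, ← mean_const (interactionLaw A E) (2 * #S)]
  exact mean_mono _ fun h => by exact_mod_cast sum_playCount_le S h

theorem sum_mean_winnerOn_playCount_le (hK : 3 ≤ K) (hε' : ε ≤ 1 / 4) (A : Algorithm K)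
    (E : Environment K n) (S : Finset (Fin n)) (hS : 1152 * ε ^ 2 * #S ≤ K) :
    ∑ k, mean (interactionLaw A (winnerOn hε S k E)) (fun h => playCount S k h) ≤
      5 / 6 * K * #S := by
  have hK' : (3 : ℝ) ≤ K := by exact_mod_cast hK
  have hfair := sum_mean_playCount_le A (fairOn S E) S
  calc ∑ k, mean (interactionLaw A (winnerOn hε S k E)) (fun h => playCount S k h)
      ≤ ∑ k : Fin K, (mean (interactionLaw A (fairOn S E)) (fun h => playCount S k h) +
          #S * (2 / 24 + 24 / 2 * (4 * ε ^ 2 *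
            mean (interactionLaw A (fairOn S E)) fun h => playCount S k h))) :=
        sum_le_sum fun k _ => mean_winnerOn_playCount_le hε hε' A E S k (by norm_num)
    _ = ∑ k, mean (interactionLaw A (fairOn S E)) (fun h => playCount S k h) +
          #S * (K / 12 + 48 * ε ^ 2 *
            ∑ k, mean (interactionLaw A (fairOn S E)) fun h => playCount S k h) := by
        simp only [sum_add_distrib, ← mul_sum, sum_const, card_univ, Fintype.card_fin, nsmul_eq_mul]
        ring
    _ ≤ 2 * #S + #S * (K / 12 + 48 * ε ^ 2 * (2 * #S)) := by gcongr
    _ ≤ 2 / 3 * K * #S + #S * (K / 12 + K / 12) := by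
        gcongr <;> linarith
    _ = 5 / 6 * K * #S := by ring

end Segment

section Averaging

variable {α β : Type*} [Fintype α] [DecidableEq α] [Fintype β]

theorem sum_sum_update (m : α) (F : (α → β) → ℝ) :
    ∑ σ : α → β, ∑ b, F (Function.update σ m b) = Fintype.card β * ∑ σ, F σ := by
  have hinv : Function.Involutive
      (fun p : (α → β) × β => (Function.update p.1 m p.2, p.1 m)) := by
    rintro ⟨σ, b⟩
    simp
  calc ∑ σ : α → β, ∑ b, F (Function.update σ m b)
      = ∑ p : (α → β) × β, F (Function.update p.1 m p.2) := (Fintype.sum_prod_type' _).symm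
    _ = ∑ p : (α → β) × β, F p.1 := Equiv.sum_comp hinv.toPerm fun p => F p.1
    _ = Fintype.card β * ∑ σ, F σ := by
        simp [Fintype.sum_prod_type, mul_sum]

theorem exists_sum_le_sum_of_le_sum_update [Nonempty β] {F : α → (α → β) → ℝ} {c : α → ℝ}
    (hF : ∀ m σ, Fintype.card β * c m ≤ ∑ b, F m (Function.update σ m b)) :
    ∃ σ, ∑ m, c m ≤ ∑ m, F m σ := by
  have hm : ∀ m, ∑ _σ : α → β, c m ≤ ∑ σ, F m σ := fun m => by
    have hβ : (0 : ℝ) < Fintype.card β := by exact_mod_cast Fintype.card_pos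
    refine le_of_mul_le_mul_left ?_ hβ
    rw [← sum_sum_update m (F m), mul_sum]
    exact sum_le_sum fun σ _ => hF m σ
  obtain ⟨σ, -, hσ⟩ : ∃ σ ∈ univ, ∑ m, c m ≤ ∑ m, F m σ := by
    refine exists_le_of_sum_le univ_nonempty ?_
    rw [sum_comm, sum_comm (s := (univ : Finset (α → β)))]
    exact sum_le_sum fun m _ => hm m
  exact ⟨σ, hσ⟩

end Averaging

section Instance

variable {K M T : ℕ}

/-- The segment `m` of an instance as a set of the time steps that index the histories. -/
def Instance.timeSteps (I : Instance K M T) (m : Fin M) : Finset (Fin T) :=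
  {t | I.segmentOf t = m}

theorem Instance.mem_timeSteps {I : Instance K M T} {m : Fin M} {t : Fin T} :
    t ∈ I.timeSteps m ↔ I.segmentOf t = m :=
  mem_filter_univ t

theorem Instance.sum_card_timeSteps (I : Instance K M T) : ∑ m, #(I.timeSteps m) = T := by
  simpa [timeSteps] using
    (card_eq_sum_card_fiberwise (f := I.segmentOf) (s := univ) (t := univ) (by simp)).symm

theorem Instance.card_timeSteps_le (I : Instance K M T) (m : Fin M) :
    #(I.timeSteps m) ≤ I.ν m.succ - I.ν m.castSucc := by
  rw [← Nat.card_Ico]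
  refine card_le_card_of_injOn (fun t => (t : ℕ) + 1) (fun t ht => ?_) fun s _ t _ hst => ?_
  · obtain rfl := mem_timeSteps.1 ht
    exact I.mem_stationarySegment_segmentOf t
  · exact Fin.ext (Nat.succ_injective hst)

theorem exists_balanced_changepoints (hM : 1 ≤ M) (hMT : M ≤ T) :
    ∃ ν : Fin (M + 1) → ℕ, StrictMono ν ∧ ν 0 = 1 ∧ ν (Fin.last M) = T + 1 ∧
      ∀ m : Fin M, ν m.succ - ν m.castSucc ≤ T / M + 1 := by
  have hpos : 1 ≤ T / M := (Nat.one_le_div_iff hM).2 hMT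
  have hstep : ∀ m, m * T / M + T / M ≤ (m + 1) * T / M ∧ (m + 1) * T / M ≤ m * T / M + T / M + 1 :=
    fun m => by
      rw [add_mul, one_mul, Nat.add_div hM]
      split_ifs <;> omega
  refine ⟨fun m => 1 + m * T / M, Fin.strictMono_iff_lt_succ.2 fun m => ?_, by simp, ?_,
    fun m => ?_⟩
  · have := (hstep m).1
    simp only [Fin.val_castSucc, Fin.val_succ]
    omega
  · simp only [Fin.val_last]
    rw [Nat.mul_div_cancel_left _ hM, add_comm]
  · have := (hstep m).2
    simp only [Fin.val_castSucc, Fin.val_succ]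
    omega

theorem exists_instance_card_timeSteps_le (hM : 1 ≤ M) (hMT : M ≤ T) (P : PreferenceMatrix K) :
    ∃ I : Instance K M T, ∀ m, M * #(I.timeSteps m) ≤ 2 * T := by
  obtain ⟨ν, hν, hν₀, hν₁, hlen⟩ := exists_balanced_changepoints hM hMT
  let I : Instance K M T := ⟨ν, hν, hν₀, hν₁, fun _ => P⟩
  refine ⟨I, fun m => ?_⟩
  calc M * #(I.timeSteps m) ≤ M * (T / M + 1) :=
        Nat.mul_le_mul_left M ((I.card_timeSteps_le m).trans (hlen m))
    _ = M * (T / M) + M := mul_add_one _ _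
    _ ≤ T + T := add_le_add (Nat.mul_div_le T M) hMT
    _ = 2 * T := (two_mul T).symm

theorem expectedWeakRegret_le_expectedBinaryWeakRegret (A : Algorithm K) (I : Instance K M T) :
    expectedWeakRegret A I ≤ expectedBinaryWeakRegret A I := by
  simp only [expectedWeakRegret, expectedBinaryWeakRegret, expectation_eq_mean]
  exact mean_mono _ fun h => sum_le_sum fun t _ => Int.le_ceil _

section WithWinners

variable {ε : ℝ} (hε : ε ∈ Set.Ioc 0 (1 / 2))

/-- The instance with the changepoints of `I` in which `σ m` is the single winner of the
segment `m`. -/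
def Instance.withWinners (I : Instance K M T) (σ : Fin M → Fin K) : Instance K M T :=
  { I with pref := fun m => singleWinner hε (σ m) }

theorem Instance.prefAt_withWinners (I : Instance K M T) (σ : Fin M → Fin K) (t : Fin T) :
    (I.withWinners hε σ).prefAt t = singleWinner hε (σ (I.segmentOf t)) :=
  rfl

theorem Instance.environment_withWinners_update (I : Instance K M T) (σ : Fin M → Fin K)
    (m : Fin M) (k : Fin K) :
    (I.withWinners hε (Function.update σ m k)).environment =
      winnerOn hε (I.timeSteps m) k (I.withWinners hε σ).environment := by
  funext t a
  by_cases ht : t ∈ I.timeSteps m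
  · simp [environment, prefAt_withWinners, winnerOn, ht, mem_timeSteps.1 ht]
  · simp [environment, prefAt_withWinners, winnerOn, ht, mt mem_timeSteps.2 ht]

theorem expectedWeakRegret_withWinners (A : Algorithm K) (I : Instance K M T)
    (σ : Fin M → Fin K) :
    expectedWeakRegret A (I.withWinners hε σ) =
      ∑ m, ε * (#(I.timeSteps m) -
        mean (interactionLaw A (I.withWinners hε σ).environment) fun h =>
          playCount (I.timeSteps m) (σ m) h) := by
  have hregret : ∀ h : History K T, ∑ t, ((I.withWinners hε σ).prefAt t).weakRegret (h t).1 =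
      ∑ m, ε * (#(I.timeSteps m) - playCount (I.timeSteps m) (σ m) h) := fun h => by
    rw [← sum_fiberwise univ I.segmentOf]
    refine sum_congr rfl fun m _ => ?_
    rw [← sum_weakRegret_singleWinner hε]
    refine sum_congr rfl fun t ht => ?_
    rw [I.prefAt_withWinners, (mem_filter.1 ht).2]
  simp only [expectedWeakRegret, expectation_eq_mean, hregret, mean_sum, mean_const_mul, mean_sub,
    mean_const]

theorem exists_winners_le_expectedWeakRegret (hK : 3 ≤ K) (hε' : ε ≤ 1 / 4) (A : Algorithm K)
    (I : Instance K M T) (hI : ∀ m, 1152 * ε ^ 2 * #(I.timeSteps m) ≤ K) :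
    ∃ σ : Fin M → Fin K, ε * T / 6 ≤ expectedWeakRegret A (I.withWinners hε σ) := by
  have : Nonempty (Fin K) := ⟨⟨0, by omega⟩⟩
  simp only [expectedWeakRegret_withWinners]
  have hT : ∑ m, ε * #(I.timeSteps m) / 6 = ε * T / 6 := by
    rw [← sum_div, ← mul_sum, ← Nat.cast_sum, I.sum_card_timeSteps]
  rw [← hT]
  refine exists_sum_le_sum_of_le_sum_update fun m σ => ?_
  have hplays := sum_mean_winnerOn_playCount_le hε hK hε' A (I.withWinners hε σ).environment
    (I.timeSteps m) (hI m)
  simp only [I.environment_withWinners_update, Function.update_self, ← mul_sum, sum_sub_distrib,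
    sum_const, card_univ, Fintype.card_fin, nsmul_eq_mul]
  have := mul_le_mul_of_nonneg_left hplays hε.1.le
  linarith

end WithWinners

theorem exists_instance_le_expectedWeakRegret (hK : 3 ≤ K) (hM : 1 ≤ M) (hMT : M ≤ T)
    {ε : ℝ} (hε : ε ∈ Set.Ioc 0 (1 / 4)) (hεT : 2304 * ε ^ 2 * T ≤ K * M) (A : Algorithm K) :
    ∃ I : Instance K M T, ε * T / 6 ≤ expectedWeakRegret A I := by
  have hε' : ε ∈ Set.Ioc (0 : ℝ) (1 / 2) := ⟨hε.1, hε.2.trans (by norm_num)⟩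
  have hK₀ : 0 < K := by omega
  obtain ⟨I, hI⟩ := exists_instance_card_timeSteps_le hM hMT (singleWinner hε' ⟨0, hK₀⟩)
  have hS : ∀ m, 1152 * ε ^ 2 * #(I.timeSteps m) ≤ K := fun m => by
    have hcard : (M : ℝ) * #(I.timeSteps m) ≤ 2 * T := by exact_mod_cast hI m
    have hM' : (0 : ℝ) < M := by exact_mod_cast hM
    refine le_of_mul_le_mul_right ?_ hM'
    calc 1152 * ε ^ 2 * #(I.timeSteps m) * M = 1152 * ε ^ 2 * (M * #(I.timeSteps m)) := by ring
      _ ≤ 1152 * ε ^ 2 * (2 * T) := by gcongr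
      _ = 2304 * ε ^ 2 * T := by ring
      _ ≤ K * M := hεT
  obtain ⟨σ, hσ⟩ := exists_winners_le_expectedWeakRegret hε' hK hε.2 A I hS
  exact ⟨_, hσ⟩

theorem exists_instance_sqrt_le_expectedWeakRegret (hK : 3 ≤ K) (hM : 1 ≤ M) (hMT : M ≤ T)
    (hKMT : M * (K - 1) ≤ 9 * T) (A : Algorithm K) :
    ∃ I : Instance K M T, 1 / 288 * √((K : ℝ) * M * T) ≤ expectedWeakRegret A I := by
  have hT : (0 : ℝ) < T := by exact_mod_cast hM.trans hMT
  have hKM : (0 : ℝ) < K * M := by exact_mod_cast Nat.mul_pos (by omega) hM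
  have hratio : (K * M : ℝ) / T ≤ 14 := by
    obtain ⟨k, rfl⟩ : ∃ k, K = k + 1 := ⟨K - 1, by omega⟩
    rw [div_le_iff₀ hT]
    norm_cast
    rw [Nat.add_sub_cancel] at hKMT
    nlinarith
  set ε : ℝ := √(K * M / T) / 48 with hε_def
  have hsq : ε ^ 2 = K * M / T / 2304 := by
    rw [hε_def, div_pow, Real.sq_sqrt (by positivity)]
    norm_num
  have hε : 0 < ε := by positivity
  have hε' : ε ≤ 1 / 4 := by nlinarith
  have hregret : ε * T / 6 = 1 / 288 * √((K : ℝ) * M * T) := by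
    have hsqrt : √((K : ℝ) * M * T) = √(K * M / T) * T := by
      rw [← Real.sqrt_mul_self hT.le, ← Real.sqrt_mul (by positivity), Real.sqrt_mul_self hT.le]
      congr 1
      field_simp
    rw [hsqrt, hε_def]
    ring
  rw [← hregret]
  refine exists_instance_le_expectedWeakRegret hK hM hMT ⟨hε, hε'⟩ ?_ A
  rw [hsq]
  field_simp
  rfl

end Instance

end DuelingBandits

end

theorem theorem5 :
    (∃ c : ℝ, 0 < c ∧ ∀ K M T : ℕ, 3 ≤ K → 1 ≤ M → M ≤ T → M * (K - 1) ≤ 9 * T →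
      ∀ A : DuelingBandits.Algorithm K, ∃ I : DuelingBandits.Instance K M T,
        c * Real.sqrt ((K : ℝ) * M * T) ≤ DuelingBandits.expectedWeakRegret A I ∧
        c * Real.sqrt ((K : ℝ) * M * T) ≤ DuelingBandits.expectedBinaryWeakRegret A I) ∧
    (∃ c : ℝ, 0 < c ∧ ∀ K T : ℕ, 3 ≤ K → 1 ≤ T → K - 1 ≤ 9 * T →
      ∀ A : DuelingBandits.Algorithm K, ∃ I : DuelingBandits.StationaryInstance K T,
        c * Real.sqrt ((K : ℝ) * T) ≤ DuelingBandits.expectedWeakRegret A I ∧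
        c * Real.sqrt ((K : ℝ) * T) ≤ DuelingBandits.expectedBinaryWeakRegret A I) := by
  refine ⟨⟨1 / 288, by norm_num, fun K M T hK hM hMT hKMT A => ?_⟩,
    ⟨1 / 288, by norm_num, fun K T hK hT hKT A => ?_⟩⟩
  · obtain ⟨I, hI⟩ :=
      DuelingBandits.exists_instance_sqrt_le_expectedWeakRegret hK hM hMT hKMT A
    exact ⟨I, hI, hI.trans (DuelingBandits.expectedWeakRegret_le_expectedBinaryWeakRegret A I)⟩
  · obtain ⟨I, hI⟩ :=
      DuelingBandits.exists_instance_sqrt_le_expectedWeakRegret hK le_rfl hT (by rwa [one_mul]) A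
    rw [Nat.cast_one, mul_one] at hI
    exact ⟨I, hI, hI.trans (DuelingBandits.expectedWeakRegret_le_expectedBinaryWeakRegret A I)⟩
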